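/- For an integer polynomial $p$, call the number of its odd coefficients $\#_{\mathrm{odd}}(p)$. For $n\ge 0$ let $f(n)=\#_{\mathrm{odd}}((1+x)^n)$, $g(n)=\#_{\mathrm{odd}}((1+x+x^2)^n)$, $u(n)=\#_{\mathrm{odd}}(r_n)$ and $v(n)=\#_{\mathrm{odd}}(q_n)$, where $r_0=1$, $r_1=1+x+x^2$, $r_n=(1+x+x^2)r_{n-1}+x^2r_{n-2}$ (Pascal's rhombus) and $q_0=1$, $q_1=x$, $q_n=xq_{n-1}+q_{n-2}$ (Fibonacci polynomials). Let $N$ be a uniform random integer in $\{0,1,\dots,n-1\}$. Then, as $n\to\infty$, $$\frac{\ln \mathrm{Var}(f(N))}{\ln n}\to\frac{\ln(5/2)}{\ln 2},\qquad \frac{\ln \mathrm{Var}(v(N))}{\ln n}\to\frac{\ln\psi}{\ln 2},\qquad \frac{\ln \mathrm{Var}(g(N))}{\ln n}\to\frac{\ln\xi}{\ln 2},\qquad \frac{\ln \mathrm{Var}(u(N))}{\ln n}\to\frac{\ln\eta}{\ln 2},$$ where $\psi=(5+\sqrt{17})/4$; $\xi=2.813\dots$ is a real number whose minimal polynomial over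 $\mathbb{Q}$ is $X^3-2X^2-3X+2$; and $\eta=3.194\dots$ is a real number whose minimal polynomial over $\mathbb{Q}$ is, up to the constant factor $4$, $4X^7-8X^6-25X^5+22X^4+24X^3+16X^2+X-2$. Moreover $5/2,\psi,\xi,\eta$ are the leading eigenvalues (eigenvalues whose modulus is maximal among all complex eigenvalues) of the matrix $\frac12(D_0\otimes D_0+D_1\otimes D_1)$, where $\otimes$ is the Kronecker product and $D_0,D_1$ are respectively - for $f$: $D_0=(1)$, $D_1=(2)$; - for $v$: $D_0=\begin{pmatrix}1&0\\1&1\end{pmatrix}$, $D_1=\begin{pmatrix}1&1\\0&1\end{pmatrix}$; - for $g$: $D_0=\begin{pmatrix}1&2\\0&0\end{pmatrix}$, $D_1=\begin{pmatrix}1&2\\1&0\end{pmatrix}$; - for $u$: $D_0=\begin{pmatrix}0&1&0&0&0\\1&0&2&0&0\\0&0&0&0&0\\0&1&0&0&1\\0&0&0&2&1\end{pmatrix}$, $D_1=\begin{pmatrix}1&0&2&0&0\\0&0&0&2&1\\1&1&0&0&0\\0&0&0&0&0\\0&1&0&0&0\end{pmatrix}$. -/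

import Mathlib

open Polynomial
open scoped Kronecker

/-- The number of odd coefficients of an integer polynomial. -/
noncomputable def oddCoeffCount (p : ℤ[X]) : ℕ :=
  Set.ncard {j : ℕ | Odd (p.coeff j)}

/-- `f n`: the number of odd coefficients of `(1 + x) ^ n`. -/
noncomputable def oddBinomial (n : ℕ) : ℕ :=
  oddCoeffCount ((1 + X) ^ n)

/-- `g n`: the number of odd coefficients of `(1 + x + x ^ 2) ^ n`. -/
noncomputable def oddTrinomial (n : ℕ) : ℕ :=
  oddCoeffCount ((1 + X + X ^ 2) ^ n)

/-- The row polynomials of Pascal's rhombus. -/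
noncomputable def rhombusPoly : ℕ → ℤ[X]
  | 0 => 1
  | 1 => 1 + X + X ^ 2
  | n + 2 => (1 + X + X ^ 2) * rhombusPoly (n + 1) + X ^ 2 * rhombusPoly n

/-- `u n`: the number of odd coefficients of the `n`-th row polynomial of Pascal's rhombus. -/
noncomputable def oddRhombus (n : ℕ) : ℕ :=
  oddCoeffCount (rhombusPoly n)

/-- The Fibonacci polynomials, indexed so that the zeroth is `1` and the first is `x`. -/
noncomputable def fibonacciPoly : ℕ → ℤ[X]
  | 0 => 1
  | 1 => X
  | n + 2 => X * fibonacciPoly (n + 1) + fibonacciPoly n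

/-- `v n`: the number of odd coefficients of the `n`-th Fibonacci polynomial. -/
noncomputable def oddFibonacci (n : ℕ) : ℕ :=
  oddCoeffCount (fibonacciPoly n)

/-- `Var (a N)` for `N` a uniform random integer between `0` and `n - 1`. -/
noncomputable def uniformVar (a : ℕ → ℕ) (n : ℕ) : ℝ :=
  ProbabilityTheory.variance (fun k : ℕ => (a k : ℝ))
    (ProbabilityTheory.uniformOn (Set.Iio n))

/-- The random variable `a N` has average dispersion `n ^ s`:
`ln (Var (a N)) / ln n → s`, where `N` is uniform on `{0, …, n - 1}`. -/
def HasAverageDispersion (a : ℕ → ℕ) (s : ℝ) : Prop :=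
  Filter.Tendsto (fun n : ℕ => Real.log (uniformVar a n) / Real.log n) Filter.atTop (nhds s)

/-- The matrix `(1/2) (D₀ ⊗ D₀ + D₁ ⊗ D₁)`. -/
noncomputable def kroneckerMean {m : ℕ} (D₀ D₁ : Matrix (Fin m) (Fin m) ℂ) :
    Matrix (Fin m × Fin m) (Fin m × Fin m) ℂ :=
  (1 / 2 : ℂ) • (D₀ ⊗ₖ D₀ + D₁ ⊗ₖ D₁)

/-- `μ` is an eigenvalue of `A`, and no complex eigenvalue of `A` has larger modulus. -/
def IsLeadingEigenvalue {ι : Type*} [Fintype ι] [DecidableEq ι] (A : Matrix ι ι ℂ) (μ : ℂ) :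
    Prop :=
  Module.End.HasEigenvalue (Matrix.toLin' A) μ ∧
    ∀ z : ℂ, Module.End.HasEigenvalue (Matrix.toLin' A) z → ‖z‖ ≤ ‖μ‖

/-- The matrix `D₀` of the binomial triangle. -/
def binomialD₀ : Matrix (Fin 1) (Fin 1) ℂ := !![1]

/-- The matrix `D₁` of the binomial triangle. -/
def binomialD₁ : Matrix (Fin 1) (Fin 1) ℂ := !![2]

/-- The matrix `D₀` of the trinomial triangle. -/
def trinomialD₀ : Matrix (Fin 2) (Fin 2) ℂ := !![1, 2; 0, 0]

/-- The matrix `D₁` of the trinomial triangle. -/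
def trinomialD₁ : Matrix (Fin 2) (Fin 2) ℂ := !![1, 2; 1, 0]

/-- The matrix `D₀` of the Fibonacci polynomials. -/
def fibonacciD₀ : Matrix (Fin 2) (Fin 2) ℂ := !![1, 0; 1, 1]

/-- The matrix `D₁` of the Fibonacci polynomials. -/
def fibonacciD₁ : Matrix (Fin 2) (Fin 2) ℂ := !![1, 1; 0, 1]

/-- The matrix `D₀` of Pascal's rhombus. -/
def rhombusD₀ : Matrix (Fin 5) (Fin 5) ℂ :=
  !![0, 1, 0, 0, 0;
     1, 0, 2, 0, 0;
     0, 0, 0, 0, 0;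
     0, 1, 0, 0, 1;
     0, 0, 0, 2, 1]

/-- The matrix `D₁` of Pascal's rhombus. -/
def rhombusD₁ : Matrix (Fin 5) (Fin 5) ℂ :=
  !![1, 0, 2, 0, 0;
     0, 0, 0, 2, 1;
     1, 1, 0, 0, 0;
     0, 0, 0, 0, 0;
     0, 1, 0, 0, 0]

/-! Modulo 2 the number of odd coefficients is a support size, and squaring is p(x) ↦ p(x²). Hence
p² + X q² has support of size |p| + |q| (`card_support_sq_add_X_mul_sq`). Writing rows 2n and 2n+1
in this shape makes each sequence a coordinate of row vectors w(n) with w(2n) = w(n)D₀ and w(2n+1) =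
w(n)D₁.

If Y ≥ 0 is an eigenvector of ½(D₀⊗D₀ + D₁⊗D₁) for r, read as a matrix, then Q(n) = w(n) Y w(n)ᵀ
satisfies Q(2n) + Q(2n+1) = 2r Q(n). So Q sums over [0, 2^m) to exactly (2r)^m Q(0). Q(n) dominates
a multiple of a(n)², and is dominated by the squares of a at 4n, …, 4n+3, so the second moment has
order r^(log₂ n). A nonnegative v with (D₀+D₁)v ≤ 2ρv bounds the mean by a multiple of ρ^(log₂ n).
Since ρ² < r, the squared mean is negligible and the variance has the order of the second moment
(`hasAverageDispersion_of_representation`).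

The same Y shows that r is a leading eigenvalue, by a Perron–Frobenius comparison
(`isLeadingEigenvalue_of_nonneg`). The minimal polynomials come from irreducibility arguments modulo
3 and 5. -/

/-! ### Support sizes over the field with two elements -/

theorem oddCoeffCount_eq_card_support (p : ℤ[X]) :
    oddCoeffCount p = (p.map (Int.castRingHom (ZMod 2))).support.card := by
  rw [oddCoeffCount, ← Set.ncard_coe_finset]
  congr 1
  ext j
  simp [ZMod.intCast_zmod_eq_zero_iff_dvd, ← even_iff_two_dvd]

theorem card_support_X_mul {R : Type*} [Semiring R] (p : R[X]) :
    (X * p).support.card = p.support.card := by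
  have : (X * p).support = p.support.map ⟨Nat.succ, Nat.succ_injective⟩ := by
    ext j
    cases j <;> simp
  rw [this, Finset.card_map]

/-- By Frobenius r(x)² = r(x²), so the two summands occupy even and odd exponents respectively and
cannot cancel. -/
theorem card_support_sq_add_X_mul_sq (p q : (ZMod 2)[X]) :
    (p ^ 2 + X * q ^ 2).support.card = p.support.card + q.support.card := by
  have hc (r : (ZMod 2)[X]) (j : ℕ) : (r ^ 2).coeff j = if 2 ∣ j then r.coeff (j / 2) else 0 := by
    rw [← ZMod.expand_card, coeff_expand two_pos]
  have : (p ^ 2 + X * q ^ 2).support =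
      p.support.image (fun j => 2 * j) ∪
        q.support.image (fun j => 2 * j + 1) := by
    ext j
    obtain ⟨k, rfl | rfl⟩ := Nat.even_or_odd' j
    · cases k with
      | zero => simp [hc]
      | succ k =>
        have : 2 * (k + 1) = (2 * k + 1) + 1 := by ring
        have h1 : ¬ 2 ∣ 2 * k + 1 := by omega
        have h2 : ∀ a, 2 * a + 1 ≠ 2 * (k + 1) := by omega
        simp only [mem_support_iff, coeff_add, Finset.mem_union, Finset.mem_image,
          h2, and_false, exists_false, or_false]
        rw [hc, this, coeff_X_mul, hc, if_neg h1, ← this]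
        simp
    · have h1 : ¬ 2 ∣ 2 * k + 1 := by omega
      have h2 : ∀ a, 2 * a ≠ 2 * k + 1 := by omega
      simp only [mem_support_iff, coeff_add, Finset.mem_union, Finset.mem_image,
        h2, and_false, exists_false, false_or]
      rw [coeff_X_mul, hc, hc, if_neg h1]
      simp
  rw [this, Finset.card_union_of_disjoint,
    Finset.card_image_of_injective _ (fun a b h => by simpa using h),
    Finset.card_image_of_injective _ (fun a b h => by simpa using h)]
  rw [Finset.disjoint_left]
  intro j
  simp only [Finset.mem_image]
  rintro ⟨a, -, rfl⟩ ⟨b, -, h⟩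
  omega

theorem card_support_sq (p : (ZMod 2)[X]) : (p ^ 2).support.card = p.support.card := by
  simpa using card_support_sq_add_X_mul_sq p 0

theorem two_eq_zero_polynomial_zmod_two : (2 : (ZMod 2)[X]) = 0 :=
  CharTwo.two_eq_zero

/-- The sequence preceded by a zero. -/
noncomputable def precededByZero (s : ℕ → (ZMod 2)[X]) : ℕ → (ZMod 2)[X]
  | 0 => 0
  | n + 1 => s n

section Doubling

variable {s : ℕ → (ZMod 2)[X]} {P T : (ZMod 2)[X]}

/-- The characteristic 2 form of the Fibonacci doubling formulas. The convention s₋₁ = 0 is the one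
that extends the recurrence to s₁ = P s₀ + T² s₋₁. The two formulas are proved together because each
step uses both. -/
theorem doubling_of_recurrence (h0 : s 0 = 1) (h1 : s 1 = P)
    (hs : ∀ n, s (n + 2) = P * s (n + 1) + T ^ 2 * s n) (n : ℕ) :
    s (2 * n) = s n ^ 2 + T ^ 2 * precededByZero s n ^ 2 ∧ s (2 * n + 1) = P * s n ^ 2 := by
  induction n with
  | zero => simp [h0, h1, precededByZero]
  | succ n ih =>
    have hn : s (n + 1) = P * s n + T ^ 2 * precededByZero s n := by
      cases n with
      | zero => simp [h0, h1, precededByZero]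
      | succ n => exact hs n
    have e1 : s (2 * (n + 1)) = s (n + 1) ^ 2 + T ^ 2 * precededByZero s (n + 1) ^ 2 := by
      rw [show 2 * (n + 1) = 2 * n + 2 by ring, hs, ih.1, ih.2, precededByZero, hn]
      linear_combination (-P * s n * T ^ 2 * precededByZero s n) *
        two_eq_zero_polynomial_zmod_two
    refine ⟨e1, ?_⟩
    rw [show 2 * (n + 1) + 1 = (2 * n + 1) + 2 by ring, hs,
      show 2 * n + 1 + 1 = 2 * (n + 1) by ring, e1, ih.2, precededByZero]
    linear_combination (P * T ^ 2 * s n ^ 2) * two_eq_zero_polynomial_zmod_two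

theorem precededByZero_two_mul (h0 : s 0 = 1) (h1 : s 1 = P)
    (hs : ∀ n, s (n + 2) = P * s (n + 1) + T ^ 2 * s n) (n : ℕ) :
    precededByZero s (2 * n) = P * precededByZero s n ^ 2 := by
  cases n with
  | zero => simp [precededByZero]
  | succ n => exact (doubling_of_recurrence h0 h1 hs n).2

end Doubling

/-! ### Linear representations of the four sequences -/

/-- The row vectors `w n` satisfy `w (2 n) = w n * D₀` and `w (2 n + 1) = w n * D₁`. -/
structure IsLinearRepresentation {m : ℕ} (D₀ D₁ : Matrix (Fin m) (Fin m) ℕ)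
    (w : ℕ → Fin m → ℕ) : Prop where
  even : ∀ n, w (2 * n) = Matrix.vecMul (w n) D₀
  odd : ∀ n, w (2 * n + 1) = Matrix.vecMul (w n) D₁

theorem oddBinomial_representation :
    IsLinearRepresentation !![1] !![2] (fun n => ![oddBinomial n]) := by
  have key (n : ℕ) : oddBinomial n = (((1 + X) ^ n : (ZMod 2)[X])).support.card := by
    simp [oddBinomial, oddCoeffCount_eq_card_support, Polynomial.map_pow, Polynomial.map_add]
  constructor
  · intro n
    ext i
    fin_cases i
    simp [Matrix.vecMul, dotProduct, key]
    rw [mul_comm, pow_mul, card_support_sq]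
  · intro n
    ext i
    fin_cases i
    simp [Matrix.vecMul, dotProduct, key]
    rw [show ((1 + X) ^ (2 * n + 1) : (ZMod 2)[X]) = ((1 + X) ^ n) ^ 2 + X * ((1 + X) ^ n) ^ 2 by
      ring, card_support_sq_add_X_mul_sq]
    ring

theorem oddTrinomial_representation :
    ∃ w, IsLinearRepresentation !![1, 2; 0, 0] !![1, 2; 1, 0] w ∧ ∀ n, w n 0 = oddTrinomial n := by
  set p : ℕ → (ZMod 2)[X] := fun n => (1 + X + X ^ 2) ^ n with hp
  have key (n : ℕ) : oddTrinomial n = (p n).support.card := by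
    simp [oddTrinomial, oddCoeffCount_eq_card_support, Polynomial.map_pow, Polynomial.map_add, hp]
  have he (n : ℕ) : p (2 * n) = p n ^ 2 := by simp only [hp]; ring
  have ho (n : ℕ) : p (2 * n + 1) = (1 + X + X ^ 2) * p n ^ 2 := by simp only [hp]; ring
  have h2 := two_eq_zero_polynomial_zmod_two
  refine ⟨fun n => ![(p n).support.card, ((1 + X) * p n).support.card], ⟨?_, ?_⟩, ?_⟩
  · intro n
    ext i
    fin_cases i
    · simp [Matrix.vecMul, dotProduct, he, card_support_sq, Fin.sum_univ_two]
    · simp [Matrix.vecMul, dotProduct, he, Fin.sum_univ_two]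
      rw [show (1 + X) * p n ^ 2 = p n ^ 2 + X * p n ^ 2 by ring, card_support_sq_add_X_mul_sq]
      ring
  · intro n
    ext i
    fin_cases i
    · simp [Matrix.vecMul, dotProduct, ho, Fin.sum_univ_two]
      rw [show (1 + X + X ^ 2) * p n ^ 2 = ((1 + X) * p n) ^ 2 + X * p n ^ 2 by
        linear_combination (-X * p n ^ 2) * h2, card_support_sq_add_X_mul_sq]
      ring
    · simp [Matrix.vecMul, dotProduct, ho, Fin.sum_univ_two]
      -- Modulo 2, (1+X)(1+X+X²) = 1 + X³.
      rw [show (1 + X) * ((1 + X + X ^ 2) * p n ^ 2) = p n ^ 2 + X * (X * p n) ^ 2 by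
        linear_combination ((X + X ^ 2) * p n ^ 2) * h2, card_support_sq_add_X_mul_sq,
        card_support_X_mul]
      ring
  · intro n
    simp [key]

theorem oddFibonacci_representation :
    ∃ w, IsLinearRepresentation !![1, 0; 1, 1] !![1, 1; 0, 1] w ∧
      ∀ n, w n 0 = oddFibonacci n := by
  set s : ℕ → (ZMod 2)[X] := fun n => (fibonacciPoly n).map (Int.castRingHom (ZMod 2)) with hs
  have key (n : ℕ) : oddFibonacci n = (s n).support.card := by
    simp [oddFibonacci, oddCoeffCount_eq_card_support, hs]
  have h0 : s 0 = 1 := by simp [hs, fibonacciPoly]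
  have h1 : s 1 = X := by simp [hs, fibonacciPoly]
  have hr (n : ℕ) : s (n + 2) = X * s (n + 1) + 1 ^ 2 * s n := by
    simp [hs, fibonacciPoly]
  have hd := doubling_of_recurrence h0 h1 hr
  have hz := precededByZero_two_mul h0 h1 hr
  have hz' (n : ℕ) : precededByZero s (2 * n + 1) = s (2 * n) := rfl
  set t := precededByZero s with ht
  have hsq (n : ℕ) : s (2 * n) = (s n + t n) ^ 2 := by
    rw [(hd n).1]
    linear_combination (-s n * t n) * two_eq_zero_polynomial_zmod_two
  have hodd (n : ℕ) : (s (2 * n + 1)).support.card = (s n).support.card := by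
    rw [(hd n).2, card_support_X_mul, card_support_sq]
  -- Consecutive Fibonacci polynomials have exponents of opposite parity: one is a square and the
  -- other is X times a square modulo 2. Nothing cancels in their sum.
  have hsum (n : ℕ) : (s n + t n).support.card = (s n).support.card + (t n).support.card := by
    obtain ⟨k, rfl | rfl⟩ := Nat.even_or_odd' n
    · rw [hsq, hz, card_support_sq_add_X_mul_sq, card_support_sq, card_support_X_mul,
        card_support_sq]
    · rw [(hd k).2, hz', hsq, add_comm, card_support_sq_add_X_mul_sq, card_support_sq,
        card_support_X_mul, card_support_sq, add_comm]
  refine ⟨fun n => ![(s n).support.card, (t n).support.card], ⟨?_, ?_⟩, ?_⟩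
  · intro n
    ext i
    fin_cases i
    · simp [Matrix.vecMul, dotProduct, Fin.sum_univ_two]
      rw [hsq, card_support_sq, hsum]
    · simp [Matrix.vecMul, dotProduct, Fin.sum_univ_two]
      rw [hz, card_support_X_mul, card_support_sq]
  · intro n
    ext i
    fin_cases i
    · simp [Matrix.vecMul, dotProduct, Fin.sum_univ_two, hodd]
    · simp [Matrix.vecMul, dotProduct, Fin.sum_univ_two]
      rw [hz', hsq, card_support_sq, hsum]
  · intro n
    simp [key]

theorem oddRhombus_representation :
    ∃ w, IsLinearRepresentation
      !![0, 1, 0, 0, 0; 1, 0, 2, 0, 0; 0, 0, 0, 0, 0; 0, 1, 0, 0, 1; 0, 0, 0, 2, 1]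
      !![1, 0, 2, 0, 0; 0, 0, 0, 2, 1; 1, 1, 0, 0, 0; 0, 0, 0, 0, 0; 0, 1, 0, 0, 0] w ∧
      ∀ n, w n 0 = oddRhombus n := by
  set s : ℕ → (ZMod 2)[X] := fun n => (rhombusPoly n).map (Int.castRingHom (ZMod 2)) with hs
  have key (n : ℕ) : oddRhombus n = (s n).support.card := by
    simp [oddRhombus, oddCoeffCount_eq_card_support, hs]
  have h0 : s 0 = 1 := by simp [hs, rhombusPoly]
  have h1 : s 1 = 1 + X + X ^ 2 := by simp [hs, rhombusPoly]
  have hr (n : ℕ) : s (n + 2) = (1 + X + X ^ 2) * s (n + 1) + X ^ 2 * s n := by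
    simp [hs, rhombusPoly]
  have hd := doubling_of_recurrence h0 h1 hr
  have hz := precededByZero_two_mul h0 h1 hr
  have hz' (n : ℕ) : precededByZero s (2 * n + 1) = s (2 * n) := rfl
  have h2 := two_eq_zero_polynomial_zmod_two
  set t := precededByZero s with ht
  -- These five combinations of rows n and n−1 are closed under splitting into even and odd
  -- exponents, up to factors of X, which do not change the support size.
  refine ⟨fun n => ![(s n).support.card, (s n + X * t n).support.card,
    ((1 + X) * s n).support.card, ((1 + X) * t n).support.card, (t n).support.card],
    ⟨?_, ?_⟩, ?_⟩
  · intro n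
    ext i
    fin_cases i <;> simp [Matrix.vecMul, dotProduct, Fin.sum_univ_five, hz, (hd n).1]
    · rw [show s n ^ 2 + X ^ 2 * t n ^ 2 = (s n + X * t n) ^ 2 by
        linear_combination (-X * s n * t n) * h2, card_support_sq]
    · rw [show s n ^ 2 + X ^ 2 * t n ^ 2 + X * ((1 + X + X ^ 2) * t n ^ 2) =
        s n ^ 2 + X * ((1 + X) * t n) ^ 2 by ring,
        card_support_sq_add_X_mul_sq]
    · rw [show (1 + X) * (s n ^ 2 + X ^ 2 * t n ^ 2) =
        (s n + X * t n) ^ 2 + X * (s n + X * t n) ^ 2 by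
          linear_combination (-(1 + X) * X * s n * t n) * h2, card_support_sq_add_X_mul_sq]
      ring
    · rw [show (1 + X) * ((1 + X + X ^ 2) * t n ^ 2) = t n ^ 2 + X * (X * t n) ^ 2 by
        linear_combination ((X + X ^ 2) * t n ^ 2) * h2, card_support_sq_add_X_mul_sq,
        card_support_X_mul]
      ring
    · rw [show (1 + X + X ^ 2) * t n ^ 2 = ((1 + X) * t n) ^ 2 + X * t n ^ 2 by
        linear_combination (-X * t n ^ 2) * h2, card_support_sq_add_X_mul_sq]
  · intro n
    ext i
    fin_cases i <;> simp [Matrix.vecMul, dotProduct, Fin.sum_univ_five, hz', (hd n).1, (hd n).2]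
    · rw [show (1 + X + X ^ 2) * s n ^ 2 = ((1 + X) * s n) ^ 2 + X * s n ^ 2 by
        linear_combination (-X * s n ^ 2) * h2, card_support_sq_add_X_mul_sq]
      ring
    · rw [show (1 + X + X ^ 2) * s n ^ 2 + X * (s n ^ 2 + X ^ 2 * t n ^ 2) =
        ((1 + X) * s n) ^ 2 + X * (X * t n) ^ 2 by ring, card_support_sq_add_X_mul_sq,
        card_support_X_mul]
    · rw [show (1 + X) * ((1 + X + X ^ 2) * s n ^ 2) = s n ^ 2 + X * (X * s n) ^ 2 by
        linear_combination ((X + X ^ 2) * s n ^ 2) * h2, card_support_sq_add_X_mul_sq,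
        card_support_X_mul]
      ring
    · rw [show (1 + X) * (s n ^ 2 + X ^ 2 * t n ^ 2) =
        (s n + X * t n) ^ 2 + X * (s n + X * t n) ^ 2 by
          linear_combination (-(1 + X) * X * s n * t n) * h2, card_support_sq_add_X_mul_sq]
      ring
    · rw [show s n ^ 2 + X ^ 2 * t n ^ 2 = (s n + X * t n) ^ 2 by
        linear_combination (-X * s n * t n) * h2, card_support_sq]
  · intro n
    simp [key]

/-! ### Irreducibility and minimal polynomials -/

/-- Every irreducible polynomial of degree 1 or 2 over 𝔽ₚ divides X^(p²) − X, so one Bézout identity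
excludes all factors of degree 1 and 2. -/
theorem not_dvd_of_isCoprime_X_pow_sub_X {p : ℕ} [Fact p.Prime] {f g : (ZMod p)[X]}
    (hf : IsCoprime f (X ^ p ^ 2 - X)) (hg : g.natDegree ≠ 0) (hg2 : g.natDegree ≤ 2) : ¬ g ∣ f := by
  intro hgf
  have hg0 : g ≠ 0 := by rintro rfl; simp at hg
  have hgu : ¬ IsUnit g := fun h => hg (natDegree_eq_zero_of_isUnit h)
  obtain ⟨q, hq, hqg⟩ := WfDvdMonoid.exists_irreducible_factor hgu hg0
  have hle := natDegree_le_of_dvd hqg hg0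
  have hpos := hq.natDegree_pos
  have hdvd : q.natDegree ∣ 2 := by
    obtain h | h : q.natDegree = 1 ∨ q.natDegree = 2 := by omega
    all_goals simp [h]
  have := hq.natDegree_dvd_iff_dvd_X_pow_card_pow_sub_X.1 hdvd
  rw [Nat.card_zmod] at this
  exact hq.not_isUnit (hf.isUnit_of_dvd' (hqg.trans hgf) this)

theorem irreducible_quintic_zmod_three :
    Irreducible (X ^ 5 + 2 * X ^ 4 + 2 * X ^ 2 + 2 * X + 1 : (ZMod 3)[X]) := by
  have : Fact (Nat.Prime 3) := ⟨Nat.prime_three⟩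
  have hdeg : (X ^ 5 + 2 * X ^ 4 + 2 * X ^ 2 + 2 * X + 1 : (ZMod 3)[X]).natDegree = 5 := by
    compute_degree!
  have hmonic : (X ^ 5 + 2 * X ^ 4 + 2 * X ^ 2 + 2 * X + 1 : (ZMod 3)[X]).Monic := by
    monicity!
  have h3 : (3 : (ZMod 3)[X]) = 0 := by exact_mod_cast CharP.cast_eq_zero (ZMod 3)[X] 3
  have hc : IsCoprime (X ^ 5 + 2 * X ^ 4 + 2 * X ^ 2 + 2 * X + 1 : (ZMod 3)[X]) (X ^ 3 ^ 2 - X) := by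
    -- Explicit Bézout coefficients modulo 3; the error is the displayed multiple of 3.
    refine ⟨1 + 2 * X ^ 3 + 2 * X ^ 4 + 2 * X ^ 6 + X ^ 7, 2 + 2 * X + 2 * X ^ 2 + 2 * X ^ 3, ?_⟩
    linear_combination (2 * X ^ 4 + 3 * X ^ 5 + 2 * X ^ 6 + 3 * X ^ 7 + 4 * X ^ 8 + 2 * X ^ 9 +
      2 * X ^ 10 + 2 * X ^ 11 + X ^ 12) * h3
  rw [hmonic.irreducible_iff_lt_natDegree_lt (by intro h; rw [h] at hdeg; simp at hdeg)]
  intro q _ hq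
  rw [hdeg, Finset.mem_Ioc] at hq
  exact not_dvd_of_isCoprime_X_pow_sub_X hc (by omega) (by omega)

/-- The integer polynomial of degree seven that has `η` as a root. -/
noncomputable def rhombusSeptic : ℤ[X] :=
  4 * X ^ 7 - 8 * X ^ 6 - 25 * X ^ 5 + 22 * X ^ 4 + 24 * X ^ 3 + 16 * X ^ 2 + X - 2

theorem natDegree_rhombusSeptic : rhombusSeptic.natDegree = 7 := by
  unfold rhombusSeptic
  compute_degree!

theorem leadingCoeff_rhombusSeptic : rhombusSeptic.leadingCoeff = 4 := by
  rw [leadingCoeff, natDegree_rhombusSeptic, rhombusSeptic]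
  simp [coeff_X, coeff_X_pow]

theorem isPrimitive_rhombusSeptic : rhombusSeptic.IsPrimitive := by
  intro r hr
  rw [C_dvd_iff_dvd_coeff] at hr
  have : rhombusSeptic.coeff 1 = 1 := by
    simp [rhombusSeptic, coeff_X, coeff_X_pow]
  exact isUnit_of_dvd_one (this ▸ hr 1)

theorem not_dvd_rhombusSeptic {b : ℤ[X]} (hb0 : b.natDegree ≠ 0) (hb2 : b.natDegree ≤ 2) :
    ¬ b ∣ rhombusSeptic := by
  intro hb
  have : Fact (Nat.Prime 5) := ⟨Nat.prime_five⟩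
  have h5 : (5 : (ZMod 5)[X]) = 0 := by exact_mod_cast CharP.cast_eq_zero (ZMod 5)[X] 5
  have hc : IsCoprime (rhombusSeptic.map (Int.castRingHom (ZMod 5))) (X ^ 5 ^ 2 - X) := by
    refine ⟨2 - X + X ^ 2 - 2 * X ^ 3 - X ^ 4 + 2 * X ^ 5 + X ^ 6 + 2 * X ^ 7 + X ^ 8 - 2 * X ^ 9 +
      2 * X ^ 10 - X ^ 11 - 2 * X ^ 13 - X ^ 14 + X ^ 16 + 2 * X ^ 17 + X ^ 18 - X ^ 19 - X ^ 21 +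
      2 * X ^ 22 + X ^ 23 + 2 * X ^ 24, -1 - X + 2 * X ^ 2 + X ^ 3 + 2 * X ^ 5 + 2 * X ^ 6, ?_⟩
    simp only [rhombusSeptic, Polynomial.map_sub, Polynomial.map_add, Polynomial.map_mul,
      Polynomial.map_pow, map_X, Polynomial.map_ofNat]
    linear_combination (-1 + X + 6 * X ^ 2 + 7 * X ^ 3 + 7 * X ^ 4 - 17 * X ^ 5 - 7 * X ^ 6 -
      10 * X ^ 7 + 16 * X ^ 8 + 30 * X ^ 9 + 6 * X ^ 10 - X ^ 11 - 9 * X ^ 12 - 9 * X ^ 13 +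
      14 * X ^ 14 - 17 * X ^ 15 - 13 * X ^ 16 - 11 * X ^ 17 + 8 * X ^ 18 + 20 * X ^ 19 +
      17 * X ^ 20 + 5 * X ^ 21 - 13 * X ^ 22 - 15 * X ^ 23 + 6 * X ^ 24 + 11 * X ^ 25 +
      24 * X ^ 26 + 6 * X ^ 27 - 10 * X ^ 29 - 2 * X ^ 30 + 2 * X ^ 31) * h5
  have hlead : Int.castRingHom (ZMod 5) b.leadingCoeff ≠ 0 := by
    intro h
    have h4 : b.leadingCoeff ∣ 4 := leadingCoeff_rhombusSeptic ▸ leadingCoeff_dvd_leadingCoeff hb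
    rw [eq_intCast, ZMod.intCast_zmod_eq_zero_iff_dvd] at h
    have := h.trans h4
    norm_num at this
  have hdeg := natDegree_map_of_leadingCoeff_ne_zero (Int.castRingHom (ZMod 5)) hlead
  exact not_dvd_of_isCoprime_X_pow_sub_X hc (hdeg ▸ hb0) (hdeg ▸ hb2) (map_dvd _ hb)

/-- Modulo 3 the septic is (X+1)² times an irreducible quintic, so in a factorization over ℤ one
factor has degree at least 5. The other then has degree at most 2, and modulo 5 no factor of degree
1 or 2 exists. Primitivity makes a constant factor a unit. -/
theorem irreducible_rhombusSeptic : Irreducible rhombusSeptic := by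
  have : Fact (Nat.Prime 3) := ⟨Nat.prime_three⟩
  have h3 : (3 : (ZMod 3)[X]) = 0 := by exact_mod_cast CharP.cast_eq_zero (ZMod 3)[X] 3
  have h0 : rhombusSeptic ≠ 0 := isPrimitive_rhombusSeptic.ne_zero
  have hunit {a : ℤ[X]} (ha : a ∣ rhombusSeptic) (hd : a.natDegree = 0) : IsUnit a := by
    rw [eq_C_of_natDegree_eq_zero hd] at ha ⊢
    exact (isPrimitive_rhombusSeptic _ ha).map C
  have hdvd : (X ^ 5 + 2 * X ^ 4 + 2 * X ^ 2 + 2 * X + 1 : (ZMod 3)[X]) ∣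
      rhombusSeptic.map (Int.castRingHom (ZMod 3)) := by
    refine ⟨(X + 1) ^ 2, ?_⟩
    simp only [rhombusSeptic, Polynomial.map_sub, Polynomial.map_add, Polynomial.map_mul,
      Polynomial.map_pow, map_X, Polynomial.map_ofNat]
    linear_combination (-1 - X + 3 * X ^ 2 + 6 * X ^ 3 + 6 * X ^ 4 - 10 * X ^ 5 - 4 * X ^ 6 +
      X ^ 7) * h3
  have key {a b : ℤ[X]} (hab : rhombusSeptic = a * b)
      (h : (X ^ 5 + 2 * X ^ 4 + 2 * X ^ 2 + 2 * X + 1 : (ZMod 3)[X]) ∣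
        a.map (Int.castRingHom (ZMod 3))) : IsUnit b := by
    have hm0 : rhombusSeptic.map (Int.castRingHom (ZMod 3)) ≠ 0 := by
      have hl : Int.castRingHom (ZMod 3) rhombusSeptic.leadingCoeff ≠ 0 := by
        rw [leadingCoeff_rhombusSeptic, eq_intCast, Ne, ZMod.intCast_zmod_eq_zero_iff_dvd]
        norm_num
      intro h
      have := natDegree_map_of_leadingCoeff_ne_zero _ hl
      rw [h, natDegree_rhombusSeptic] at this
      simp at this
    have ha0 : a.map (Int.castRingHom (ZMod 3)) ≠ 0 := by
      intro h
      rw [hab, Polynomial.map_mul, h, zero_mul] at hm0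
      exact hm0 rfl
    have h5 : (X ^ 5 + 2 * X ^ 4 + 2 * X ^ 2 + 2 * X + 1 : (ZMod 3)[X]).natDegree = 5 := by
      compute_degree!
    have h1 := natDegree_le_of_dvd h ha0
    have h2 := h1.trans natDegree_map_le
    have h7 : a.natDegree + b.natDegree = 7 := by
      rw [← natDegree_rhombusSeptic, hab, natDegree_mul]
      · rintro rfl; simp [hab] at h0
      · rintro rfl; simp [hab] at h0
    have hb : b ∣ rhombusSeptic := hab ▸ dvd_mul_left b a
    by_contra hb'
    exact not_dvd_rhombusSeptic (fun h => hb' (hunit hb h)) (by omega) hb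
  refine ⟨fun h => ?_, fun a b hab => ?_⟩
  · have := natDegree_eq_zero_of_isUnit h
    rw [natDegree_rhombusSeptic] at this
    omega
  · rw [hab, Polynomial.map_mul] at hdvd
    rcases irreducible_quintic_zmod_three.prime.dvd_or_dvd hdvd with h | h
    · exact Or.inr (key hab h)
    · exact Or.inl (key (hab.trans (mul_comm a b)) h)

theorem four_mul_minpoly_eq {η : ℝ} (h : 4 * η ^ 7 - 8 * η ^ 6 - 25 * η ^ 5 + 22 * η ^ 4 +
    24 * η ^ 3 + 16 * η ^ 2 + η - 2 = 0) :
    4 * minpoly ℚ η =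
      4 * X ^ 7 - 8 * X ^ 6 - 25 * X ^ 5 + 22 * X ^ 4 + 24 * X ^ 3 + 16 * X ^ 2 + X - 2 := by
  have hirr := (IsPrimitive.Int.irreducible_iff_irreducible_map_cast isPrimitive_rhombusSeptic).1
    irreducible_rhombusSeptic
  have hlead : (rhombusSeptic.map (Int.castRingHom ℚ)).leadingCoeff = 4 := by
    rw [leadingCoeff_map_of_injective (RingHom.injective_int _), leadingCoeff_rhombusSeptic]
    simp
  have hroot : aeval η (rhombusSeptic.map (Int.castRingHom ℚ)) = 0 := by
    simp only [rhombusSeptic, Polynomial.map_sub, Polynomial.map_add, Polynomial.map_mul,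
      Polynomial.map_pow, map_X, Polynomial.map_ofNat, map_sub, map_add, map_mul, map_pow, aeval_X,
      map_ofNat]
    exact h
  rw [← minpoly.eq_of_irreducible hirr hroot, hlead]
  have : (4 : ℚ[X]) * C (4⁻¹) = 1 := by
    rw [show (4 : ℚ[X]) = C 4 from rfl, ← C_mul]
    norm_num
  rw [mul_left_comm, this, mul_one]
  simp [rhombusSeptic]

/-- The cubic is monic without roots modulo 3, hence irreducible over ℤ and, by Gauss's lemma, over
ℚ. -/
theorem minpoly_eq_cubic {ξ : ℝ} (h : ξ ^ 3 - 2 * ξ ^ 2 - 3 * ξ + 2 = 0) :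
    minpoly ℚ ξ = X ^ 3 - 2 * X ^ 2 - 3 * X + 2 := by
  have hdeg : (X ^ 3 - 2 * X ^ 2 - 3 * X + 2 : ℤ[X]).natDegree = 3 := by compute_degree!
  have hroot : ∀ x : ZMod 3, x ^ 3 - 2 * x ^ 2 - 3 * x + 2 ≠ 0 := by decide
  have hmonic : (X ^ 3 - 2 * X ^ 2 - 3 * X + 2 : ℤ[X]).Monic := by monicity!
  have : Fact (Nat.Prime 3) := ⟨Nat.prime_three⟩
  have hirr3 : Irreducible ((X ^ 3 - 2 * X ^ 2 - 3 * X + 2 : ℤ[X]).map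
      (Int.castRingHom (ZMod 3))) := by
    have hd := (hmonic.natDegree_map (Int.castRingHom (ZMod 3))).trans hdeg
    rw [irreducible_iff_roots_eq_zero_of_degree_le_three (by omega) (by omega)]
    refine Multiset.eq_zero_of_forall_notMem fun x hx => ?_
    have hx := (mem_roots'.1 hx).2
    simp only [IsRoot.def, Polynomial.map_sub, Polynomial.map_add, Polynomial.map_mul,
      Polynomial.map_pow, map_X, Polynomial.map_ofNat, eval_add, eval_sub, eval_mul, eval_pow,
      eval_X, eval_ofNat] at hx
    exact hroot x hx
  have hirr := hmonic.irreducible_of_irreducible_map _ _ hirr3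
  have hirrQ := (IsPrimitive.Int.irreducible_iff_irreducible_map_cast hmonic.isPrimitive).1 hirr
  have he : (X ^ 3 - 2 * X ^ 2 - 3 * X + 2 : ℤ[X]).map (Int.castRingHom ℚ) =
      X ^ 3 - 2 * X ^ 2 - 3 * X + 2 := by simp
  rw [← he]
  refine (minpoly.eq_of_irreducible_of_monic hirrQ ?_ (hmonic.map _)).symm
  rw [he]
  simpa [map_ofNat] using h

/-! ### Leading eigenvalues and the quadratic form -/

/-- A nonnegative eigenvector of a nonnegative matrix that vanishes only at zero rows of the matrix
belongs to a leading eigenvalue. -/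
theorem isLeadingEigenvalue_of_nonneg {ι : Type*} [Fintype ι] [DecidableEq ι] {A : Matrix ι ι ℝ}
    {y : ι → ℝ} {r : ℝ} (hr : 0 ≤ r) (hA : ∀ i j, 0 ≤ A i j) (hy : ∀ i, 0 ≤ y i) (hy0 : y ≠ 0)
    (hzero : ∀ i, y i = 0 → ∀ j, A i j = 0) (hE : ∀ i, ∑ j, A i j * y j = r * y i) :
    IsLeadingEigenvalue (A.map (fun x : ℝ => (x : ℂ))) (r : ℂ) := by
  constructor
  · refine Module.End.hasEigenvalue_of_hasEigenvector (x := fun i => (y i : ℂ)) ⟨?_, ?_⟩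
    · rw [Module.End.mem_eigenspace_iff]
      ext i
      simp only [Matrix.toLin'_apply, Matrix.mulVec, dotProduct, Matrix.map_apply, Pi.smul_apply,
        smul_eq_mul]
      exact_mod_cast hE i
    · intro h
      apply hy0
      ext i
      simpa using congrFun h i
  · intro z hz
    obtain ⟨x, hx⟩ := hz.exists_hasEigenvector
    have hx0 := hx.2
    have hx1 (i : ι) : ∑ j, (A i j : ℂ) * x j = z * x i := by
      have := congrFun (Module.End.mem_eigenspace_iff.1 hx.1) i
      simpa [Matrix.toLin'_apply, Matrix.mulVec, dotProduct] using this
    rw [Complex.norm_real, Real.norm_of_nonneg hr]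
    by_cases hz0 : z = 0
    · simpa [hz0] using hr
    -- A zero row gives z xᵢ = 0, so x is supported where y > 0. The ratio maximized next is 0 by
    -- convention where y vanishes, which is harmless.
    have hsupp (i : ι) (hi : y i = 0) : x i = 0 := by
      have := hx1 i
      simp only [hzero i hi, Complex.ofReal_zero, zero_mul, Finset.sum_const_zero] at this
      exact (mul_eq_zero.1 this.symm).resolve_left hz0
    obtain ⟨i₀, hi₀⟩ := Function.ne_iff.1 hx0
    obtain ⟨i, -, hi⟩ := Finset.exists_max_image Finset.univ (fun i => ‖x i‖ / y i)
      ⟨i₀, Finset.mem_univ _⟩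
    set t := ‖x i‖ / y i with ht
    have hle (j : ι) : ‖x j‖ ≤ t * y j := by
      rcases (hy j).eq_or_lt with h | h
      · simp [hsupp j h.symm, ← h]
      · exact (div_le_iff₀ h).1 (hi j (Finset.mem_univ _))
    have htpos : 0 < t := by
      have : 0 < ‖x i₀‖ := norm_pos_iff.2 hi₀
      exact pos_of_mul_pos_left (this.trans_le (hle i₀)) (hy i₀)
    have hyi : 0 < y i := (hy i).lt_of_ne fun h => by simp [ht, ← h] at htpos
    have hxi : ‖x i‖ = t * y i := by rw [ht, div_mul_cancel₀ _ hyi.ne']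
    have : ‖z‖ * (t * y i) ≤ r * (t * y i) := by
      calc ‖z‖ * (t * y i) = ‖∑ j, (A i j : ℂ) * x j‖ := by rw [hx1, norm_mul, hxi]
        _ ≤ ∑ j, A i j * (t * y j) := by
          refine (norm_sum_le _ _).trans (Finset.sum_le_sum fun j _ => ?_)
          rw [norm_mul, Complex.norm_real, Real.norm_of_nonneg (hA i j)]
          exact mul_le_mul_of_nonneg_left (hle j) (hA i j)
        _ = r * (t * y i) := by
          simp only [mul_left_comm _ t, ← Finset.mul_sum, hE]
    exact le_of_mul_le_mul_right this (by positivity)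

/-- A nonnegative matrix `Y` with `D₀ Y D₀ᵀ + D₁ Y D₁ᵀ = 2 r Y`, and whose zero entries
are forced by zero rows of `D₀ ⊗ D₀ + D₁ ⊗ D₁`. -/
structure IsKroneckerEigenvector {m : ℕ} (D₀ D₁ : Matrix (Fin m) (Fin m) ℕ)
    (Y : Matrix (Fin m) (Fin m) ℝ) (r : ℝ) : Prop where
  nonneg : ∀ i j, 0 ≤ Y i j
  zero_row : ∀ i j, Y i j = 0 → ∀ k l, D₀ i k * D₀ j l + D₁ i k * D₁ j l = 0
  eigen : ∀ i j, ∑ k, ∑ l, ((D₀ i k * D₀ j l + D₁ i k * D₁ j l : ℕ) : ℝ) * Y k l = 2 * r * Y i j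

theorem IsKroneckerEigenvector.isLeadingEigenvalue {m : ℕ} {D₀ D₁ : Matrix (Fin m) (Fin m) ℕ}
    {Y : Matrix (Fin m) (Fin m) ℝ} {r : ℝ} (h : IsKroneckerEigenvector D₀ D₁ Y r) (hr : 0 ≤ r)
    (hY : Y ≠ 0) :
    IsLeadingEigenvalue (kroneckerMean (D₀.map (fun x : ℕ => (x : ℂ)))
      (D₁.map (fun x : ℕ => (x : ℂ)))) (r : ℂ) := by
  set A : Matrix (Fin m × Fin m) (Fin m × Fin m) ℝ :=
    fun i j => ((D₀ i.1 j.1 * D₀ i.2 j.2 + D₁ i.1 j.1 * D₁ i.2 j.2 : ℕ) : ℝ) / 2 with hA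
  have : kroneckerMean (D₀.map (fun x : ℕ => (x : ℂ))) (D₁.map (fun x : ℕ => (x : ℂ))) =
      A.map (fun x : ℝ => (x : ℂ)) := by
    ext ⟨i, j⟩ ⟨k, l⟩
    rw [Matrix.map_apply]
    simp [kroneckerMean, hA]
    ring
  rw [this]
  refine isLeadingEigenvalue_of_nonneg (y := fun i => Y i.1 i.2) hr
    (fun i j => by simp only [hA]; positivity) (fun i => h.nonneg _ _) ?_ ?_ ?_
  · intro h0
    apply hY
    ext i j
    exact congrFun h0 (i, j)
  · intro i hi j
    simp only [hA, h.zero_row _ _ hi, Nat.cast_zero, zero_div]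
  · intro i
    rw [Fintype.sum_prod_type]
    have := h.eigen i.1 i.2
    simp only [hA, div_mul_eq_mul_div, ← Finset.sum_div]
    rw [this]
    ring

/-- The quadratic form of a Kronecker eigenvector satisfies a two-term recursion along a linear
representation. -/
theorem IsKroneckerEigenvector.quadratic_recursion {m : ℕ} {D₀ D₁ : Matrix (Fin m) (Fin m) ℕ}
    {Y : Matrix (Fin m) (Fin m) ℝ} {r : ℝ} (h : IsKroneckerEigenvector D₀ D₁ Y r)
    {w : ℕ → Fin m → ℕ} (hw : IsLinearRepresentation D₀ D₁ w) (n : ℕ) :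
    ∑ i, ∑ j, (w (2 * n) i : ℝ) * w (2 * n) j * Y i j +
      ∑ i, ∑ j, (w (2 * n + 1) i : ℝ) * w (2 * n + 1) j * Y i j =
    2 * r * ∑ i, ∑ j, (w n i : ℝ) * w n j * Y i j := by
  have expand (D : Matrix (Fin m) (Fin m) ℕ) :
      ∑ k, ∑ l, ((Matrix.vecMul (w n) D k : ℕ) : ℝ) * ((Matrix.vecMul (w n) D l : ℕ) : ℝ) * Y k l =
      ∑ i, ∑ j, (w n i : ℝ) * w n j * ∑ k, ∑ l, ((D i k * D j l : ℕ) : ℝ) * Y k l := by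
    have hs (k l : Fin m) :
        ((Matrix.vecMul (w n) D k : ℕ) : ℝ) * ((Matrix.vecMul (w n) D l : ℕ) : ℝ) * Y k l =
        ∑ i, ∑ j, (w n i : ℝ) * w n j * (((D i k * D j l : ℕ) : ℝ) * Y k l) := by
      simp only [Matrix.vecMul, dotProduct, Nat.cast_sum, Nat.cast_mul]
      rw [Finset.sum_mul_sum, Finset.sum_mul]
      simp only [Finset.sum_mul]
      refine Finset.sum_congr rfl fun i _ => Finset.sum_congr rfl fun j _ => ?_
      ring
    simp only [hs, Finset.mul_sum]
    calc _ = ∑ k, ∑ i, ∑ l, ∑ j, (w n i : ℝ) * w n j * (((D i k * D j l : ℕ) : ℝ) * Y k l) :=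
          Finset.sum_congr rfl fun k _ => Finset.sum_comm
      _ = ∑ i, ∑ k, ∑ l, ∑ j, (w n i : ℝ) * w n j * (((D i k * D j l : ℕ) : ℝ) * Y k l) :=
          Finset.sum_comm
      _ = ∑ i, ∑ k, ∑ j, ∑ l, (w n i : ℝ) * w n j * (((D i k * D j l : ℕ) : ℝ) * Y k l) :=
          Finset.sum_congr rfl fun i _ => Finset.sum_congr rfl fun k _ => Finset.sum_comm
      _ = _ := Finset.sum_congr rfl fun i _ => Finset.sum_comm
  rw [hw.even, hw.odd, expand, expand, ← Finset.sum_add_distrib, Finset.mul_sum]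
  refine Finset.sum_congr rfl fun i _ => ?_
  rw [← Finset.sum_add_distrib, Finset.mul_sum]
  refine Finset.sum_congr rfl fun j _ => ?_
  have := h.eigen i j
  simp only [Nat.cast_add, add_mul, Finset.sum_add_distrib] at this
  rw [← mul_add, this]
  ring

/-! ### Variance and dyadic sums -/

open MeasureTheory ProbabilityTheory in
theorem integral_uniformOn_Iio {n : ℕ} (f : ℕ → ℝ) :
    ∫ k, f k ∂(uniformOn (Set.Iio n)) = (∑ k ∈ Finset.range n, f k) / n := by
  have hfin : (Set.Iio n : Set ℕ) = (Finset.range n : Set ℕ) := by ext; simp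
  rw [uniformOn, ProbabilityTheory.cond, hfin, integral_smul_measure, setIntegral_finset]
  · simp only [measureReal_def, Measure.count_singleton, ENNReal.toReal_one, one_mul,
      Measure.count_apply_finset, ENNReal.toReal_inv, ENNReal.toReal_natCast,
      Finset.card_range, smul_eq_mul]
    rw [div_eq_inv_mul]
  · have : IsFiniteMeasure (Measure.count.restrict (Finset.range n : Set ℕ)) :=
      ⟨by simp⟩
    have := IntegrableOn.finset (μ := Measure.count.restrict (Finset.range n : Set ℕ))
      (s := Finset.range n) (f := f)
    simpa [IntegrableOn] using this

open MeasureTheory ProbabilityTheory in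
theorem uniformVar_eq (a : ℕ → ℕ) {n : ℕ} (hn : n ≠ 0) :
    uniformVar a n = (∑ k ∈ Finset.range n, (a k : ℝ) ^ 2) / n -
      ((∑ k ∈ Finset.range n, (a k : ℝ)) / n) ^ 2 := by
  have hfin : (Set.Iio n).Finite := Set.finite_Iio n
  have : IsProbabilityMeasure (uniformOn (Set.Iio n) : Measure ℕ) :=
    isProbabilityMeasure_uniformOn hfin ⟨0, Nat.pos_of_ne_zero hn⟩
  rw [uniformVar, variance_eq_sub]
  · simp only [Pi.pow_apply, integral_uniformOn_Iio]
  · refine memLp_of_bounded (a := 0) (b := ∑ k ∈ Finset.range n, (a k : ℝ))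
      (ae_cond_of_forall_mem measurableSet_Iio fun k hk => ⟨Nat.cast_nonneg _, ?_⟩)
      (measurable_of_countable _).aestronglyMeasurable 2
    exact Finset.single_le_sum (f := fun k => (a k : ℝ)) (fun k _ => Nat.cast_nonneg _)
      (Finset.mem_range.2 hk)

theorem sum_range_two_mul (f : ℕ → ℝ) (n : ℕ) :
    ∑ k ∈ Finset.range (2 * n), f k = ∑ k ∈ Finset.range n, (f (2 * k) + f (2 * k + 1)) := by
  induction n with
  | zero => simp
  | succ n ih =>
    rw [show 2 * (n + 1) = 2 * n + 1 + 1 by ring, Finset.sum_range_succ, Finset.sum_range_succ, ih,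
      Finset.sum_range_succ]
    ring

theorem sum_range_two_pow_eq {f : ℕ → ℝ} {r : ℝ} (hf : ∀ n, f (2 * n) + f (2 * n + 1) = r * f n)
    (m : ℕ) : ∑ k ∈ Finset.range (2 ^ m), f k = r ^ m * f 0 := by
  induction m with
  | zero => simp
  | succ m ih =>
    rw [pow_succ', sum_range_two_mul]
    simp only [hf, ← Finset.mul_sum, ih]
    ring

theorem sum_range_two_pow_le {f : ℕ → ℝ} {r : ℝ} (hr : 0 ≤ r)
    (hf : ∀ n, f (2 * n) + f (2 * n + 1) ≤ r * f n) (m : ℕ) :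
    ∑ k ∈ Finset.range (2 ^ m), f k ≤ r ^ m * f 0 := by
  induction m with
  | zero => simp
  | succ m ih =>
    rw [pow_succ', sum_range_two_mul]
    calc _ ≤ ∑ k ∈ Finset.range (2 ^ m), r * f k := Finset.sum_le_sum fun k _ => hf k
      _ ≤ r * (r ^ m * f 0) := by
        rw [← Finset.mul_sum]
        exact mul_le_mul_of_nonneg_left ih hr
      _ = _ := by ring

/-- If `V n` is comparable to `r ^ ⌊log₂ n⌋`, then `log (V n) / log n → log r / log 2`. -/
theorem tendsto_log_div_log_of_bounds {V : ℕ → ℝ} {r c C : ℝ} (hr : 0 < r) (hc : 0 < c)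
    (hl : ∀ᶠ n in Filter.atTop, c * r ^ Nat.log 2 n ≤ V n)
    (hu : ∀ᶠ n in Filter.atTop, V n ≤ C * r ^ Nat.log 2 n) :
    Filter.Tendsto (fun n : ℕ => Real.log (V n) / Real.log n) Filter.atTop
      (nhds (Real.log r / Real.log 2)) := by
  have hlog2 : 0 < Real.log 2 := Real.log_pos one_lt_two
  set s := Real.log r / Real.log 2 with hs
  -- The first term absorbs the constants c and C, the second the gap of at most log 2 between log n
  -- and ⌊log₂ n⌋ log 2.
  set K := max |Real.log c| |Real.log C| + |s| * Real.log 2 with hK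
  have hlogn : Filter.Tendsto (fun n : ℕ => Real.log n) Filter.atTop Filter.atTop :=
    Real.tendsto_log_atTop.comp tendsto_natCast_atTop_atTop
  rw [← tendsto_sub_nhds_zero_iff]
  refine squeeze_zero_norm' ?_ (hlogn.const_div_atTop K)
  filter_upwards [hl, hu, Filter.eventually_gt_atTop 1] with n hln hun hn
  have hlog : 0 < Real.log n := Real.log_pos (by exact_mod_cast hn)
  set m := Nat.log 2 n with hm
  have hpow : 0 < r ^ m := pow_pos hr m
  have hV : 0 < V n := (mul_pos hc hpow).trans_le hln
  have hC : 0 < C := pos_of_mul_pos_left (hV.trans_le hun) hpow.le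
  have h1 : Real.log c + m * Real.log r ≤ Real.log (V n) := by
    rw [← Real.log_pow, ← Real.log_mul hc.ne' hpow.ne']
    exact Real.log_le_log (mul_pos hc hpow) hln
  have h2 : Real.log (V n) ≤ Real.log C + m * Real.log r := by
    rw [← Real.log_pow, ← Real.log_mul hC.ne' hpow.ne']
    exact Real.log_le_log hV hun
  have h3 : m * Real.log 2 ≤ Real.log n := by
    rw [← Real.log_pow]
    exact Real.log_le_log (by positivity) (by exact_mod_cast Nat.pow_log_le_self 2 (by omega))
  have h4 : Real.log n ≤ m * Real.log 2 + Real.log 2 := by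
    have : (n : ℝ) ≤ 2 ^ (m + 1) := by
      exact_mod_cast (Nat.lt_pow_succ_log_self one_lt_two n).le
    calc Real.log n ≤ Real.log (2 ^ (m + 1)) := Real.log_le_log (by positivity) this
      _ = _ := by rw [Real.log_pow]; push_cast; ring
  have h5 : |Real.log (V n) - m * Real.log r| ≤ max |Real.log c| |Real.log C| := by
    rw [abs_le]
    constructor
    · linarith [neg_abs_le (Real.log c), le_max_left |Real.log c| |Real.log C|]
    · linarith [le_abs_self (Real.log C), le_max_right |Real.log c| |Real.log C|]
  have h6 : |s * (m * Real.log 2 - Real.log n)| ≤ |s| * Real.log 2 := by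
    rw [abs_mul]
    refine mul_le_mul_of_nonneg_left ?_ (abs_nonneg s)
    rw [abs_le]
    constructor <;> linarith
  have h7 : s * Real.log 2 = Real.log r := div_mul_cancel₀ _ hlog2.ne'
  have h8 : Real.log (V n) / Real.log n - s =
      (Real.log (V n) - m * Real.log r + s * (m * Real.log 2 - Real.log n)) / Real.log n := by
    field_simp
    rw [← h7]
    ring
  rw [Real.norm_eq_abs, h8, abs_div, abs_of_pos hlog]
  exact div_le_div_of_nonneg_right ((abs_add_le _ _).trans (add_le_add h5 h6)) hlog.le

/-- Exponential bounds on the first two moments over dyadic intervals determine the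
average dispersion. -/
theorem hasAverageDispersion_of_dyadic_bounds {a : ℕ → ℕ} {r ρ c C C' : ℝ} (hr : 0 < r)
    (hρr : ρ ^ 2 < r) (hc : 0 < c)
    (hl : ∀ m, 2 ≤ m → c * (2 * r) ^ m ≤ ∑ k ∈ Finset.range (2 ^ m), (a k : ℝ) ^ 2)
    (hu : ∀ m, ∑ k ∈ Finset.range (2 ^ m), (a k : ℝ) ^ 2 ≤ C * (2 * r) ^ m)
    (h1 : ∀ m, ∑ k ∈ Finset.range (2 ^ m), (a k : ℝ) ≤ C' * (2 * ρ) ^ m) :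
    HasAverageDispersion a (Real.log r / Real.log 2) := by
  have hlogtop : Filter.Tendsto (Nat.log 2) Filter.atTop Filter.atTop :=
    Filter.tendsto_atTop_atTop.2 fun b => ⟨2 ^ b, fun n hn => Nat.le_log_of_pow_le one_lt_two hn⟩
  have mono {f : ℕ → ℝ} (hf : ∀ k, 0 ≤ f k) {i j : ℕ} (hij : i ≤ j) :
      ∑ k ∈ Finset.range i, f k ≤ ∑ k ∈ Finset.range j, f k :=
    Finset.sum_le_sum_of_subset_of_nonneg (Finset.range_mono hij) fun k _ _ => hf k
  -- With 2^m ≤ n < 2^(m+1), the second moment is at least (c/2) r^m, and the squared mean is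
  -- eventually at most (c/4) r^m because ρ² < r.
  refine tendsto_log_div_log_of_bounds (c := c / 4) (C := 2 * C * r) hr (by positivity) ?_ ?_
  · have hq : Filter.Tendsto (fun m : ℕ => (2 * C' * ρ) ^ 2 * (ρ ^ 2 / r) ^ m) Filter.atTop
        (nhds 0) := by
      simpa using (tendsto_pow_atTop_nhds_zero_of_lt_one (by positivity)
        ((div_lt_one hr).2 hρr)).const_mul ((2 * C' * ρ) ^ 2)
    have hq' := hlogtop.eventually (hq.eventually (gt_mem_nhds (show 0 < c / 4 by positivity)))
    filter_upwards [hq', hlogtop.eventually (Filter.eventually_ge_atTop 2),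
      Filter.eventually_ge_atTop 1] with n hqn hm2 hn
    rw [uniformVar_eq a (by omega)]
    set m := Nat.log 2 n with hm
    have hn1 : (2 : ℝ) ^ m ≤ n := by exact_mod_cast Nat.pow_log_le_self 2 (by omega)
    have hn2 : (n : ℝ) ≤ 2 ^ (m + 1) := by
      exact_mod_cast (Nat.lt_pow_succ_log_self one_lt_two n).le
    have hn0 : (0 : ℝ) < n := by exact_mod_cast hn
    have e1 : c / 2 * r ^ m ≤ (∑ k ∈ Finset.range n, (a k : ℝ) ^ 2) / n := by
      rw [le_div_iff₀ hn0]
      calc c / 2 * r ^ m * n ≤ c / 2 * r ^ m * 2 ^ (m + 1) :=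
            mul_le_mul_of_nonneg_left hn2 (by positivity)
        _ = c * (2 * r) ^ m := by rw [mul_pow]; ring
        _ ≤ _ := hl m hm2
        _ ≤ _ := mono (fun k => by positivity) (Nat.pow_log_le_self 2 (by omega))
    have e2 : (∑ k ∈ Finset.range n, (a k : ℝ)) / n ≤ 2 * C' * ρ * ρ ^ m := by
      have hs : ∑ k ∈ Finset.range n, (a k : ℝ) ≤ C' * (2 * ρ) ^ (m + 1) :=
        (mono (fun k => by positivity) (Nat.lt_pow_succ_log_self one_lt_two n).le).trans (h1 _)
      calc (∑ k ∈ Finset.range n, (a k : ℝ)) / n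
          ≤ (∑ k ∈ Finset.range n, (a k : ℝ)) / 2 ^ m := by gcongr
        _ ≤ C' * (2 * ρ) ^ (m + 1) / 2 ^ m := by gcongr
        _ = 2 * C' * ρ * ρ ^ m := by
          rw [mul_pow]
          field_simp
          ring
    have e3 : ((∑ k ∈ Finset.range n, (a k : ℝ)) / n) ^ 2 ≤ c / 4 * r ^ m := by
      calc _ ≤ (2 * C' * ρ * ρ ^ m) ^ 2 := by gcongr
        _ = ((2 * C' * ρ) ^ 2 * (ρ ^ 2 / r) ^ m) * r ^ m := by
          rw [div_pow, mul_pow, ← pow_mul, ← pow_mul, mul_comm m 2, mul_assoc _ _ (r ^ m),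
            div_mul_cancel₀ _ (pow_pos hr m).ne']
        _ ≤ c / 4 * r ^ m := by gcongr
    linarith
  · filter_upwards [Filter.eventually_ge_atTop 1] with n hn
    rw [uniformVar_eq a (by omega)]
    set m := Nat.log 2 n with hm
    have hn1 : (2 : ℝ) ^ m ≤ n := by exact_mod_cast Nat.pow_log_le_self 2 (by omega)
    have hs : ∑ k ∈ Finset.range n, (a k : ℝ) ^ 2 ≤ C * (2 * r) ^ (m + 1) :=
      (mono (fun k => by positivity) (Nat.lt_pow_succ_log_self one_lt_two n).le).trans (hu _)
    calc _ ≤ (∑ k ∈ Finset.range n, (a k : ℝ) ^ 2) / n := sub_le_self _ (sq_nonneg _)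
      _ ≤ (∑ k ∈ Finset.range n, (a k : ℝ) ^ 2) / 2 ^ m := by gcongr
      _ ≤ C * (2 * r) ^ (m + 1) / 2 ^ m := by gcongr
      _ = 2 * C * r * r ^ m := by
        rw [mul_pow]
        field_simp
        ring

/-- `hY` makes the sums of Q exactly geometric. `hY0` gives a² ≤ Q/Y(i₀,i₀), and `hcover` gives the
converse: two further binary digits suffice for a to see every coordinate of w. `hvρ` controls the
first moment. -/
theorem hasAverageDispersion_of_representation {d : ℕ} {D₀ D₁ : Matrix (Fin d) (Fin d) ℕ}
    {Y : Matrix (Fin d) (Fin d) ℝ} {r ρ : ℝ} {w : ℕ → Fin d → ℕ} {a : ℕ → ℕ} {i₀ : Fin d}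
    {v : Fin d → ℝ} (hY : IsKroneckerEigenvector D₀ D₁ Y r) (hw : IsLinearRepresentation D₀ D₁ w)
    (ha : ∀ n, w n i₀ = a n) (ha0 : 0 < a 0) (hY0 : 0 < Y i₀ i₀)
    (hcover : ∀ n i, w n i ≤ a (4 * n) + a (4 * n + 1) + a (4 * n + 2) + a (4 * n + 3))
    (hv : ∀ i, 0 ≤ v i) (hv0 : 0 < v i₀)
    (hvρ : ∀ i, ∑ j, ((D₀ i j + D₁ i j : ℕ) : ℝ) * v j ≤ 2 * ρ * v i)
    (hρ : 0 ≤ ρ) (hρr : ρ ^ 2 < r) :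
    HasAverageDispersion a (Real.log r / Real.log 2) := by
  have hr : 0 < r := (sq_nonneg ρ).trans_lt hρr
  set Q : ℕ → ℝ := fun n => ∑ i, ∑ j, (w n i : ℝ) * w n j * Y i j with hQ
  set L : ℕ → ℝ := fun n => ∑ i, (w n i : ℝ) * v i with hL
  have hQsum := sum_range_two_pow_eq (f := Q) (hY.quadratic_recursion hw)
  have hLrec (n : ℕ) : L (2 * n) + L (2 * n + 1) ≤ 2 * ρ * L n := by
    have expand (D : Matrix (Fin d) (Fin d) ℕ) :
        ∑ j, ((Matrix.vecMul (w n) D j : ℕ) : ℝ) * v j =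
          ∑ i, (w n i : ℝ) * ∑ j, (D i j : ℝ) * v j := by
      simp only [Matrix.vecMul, dotProduct, Nat.cast_sum, Nat.cast_mul, Finset.sum_mul,
        Finset.mul_sum]
      rw [Finset.sum_comm]
      simp only [mul_assoc]
    simp only [hL]
    rw [hw.even, hw.odd, expand, expand, ← Finset.sum_add_distrib, Finset.mul_sum]
    refine Finset.sum_le_sum fun i _ => ?_
    rw [← mul_add, ← Finset.sum_add_distrib, mul_left_comm]
    refine mul_le_mul_of_nonneg_left ?_ (Nat.cast_nonneg _)
    simpa only [Nat.cast_add, add_mul] using hvρ i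
  have hLsum := sum_range_two_pow_le (f := L) (by positivity) hLrec
  have hLa (n : ℕ) : v i₀ * a n ≤ L n := by
    rw [mul_comm, ← ha]
    exact Finset.single_le_sum (f := fun i => (w n i : ℝ) * v i)
      (fun i _ => mul_nonneg (Nat.cast_nonneg _) (hv i)) (Finset.mem_univ i₀)
  have hterm (n : ℕ) (i j : Fin d) : 0 ≤ (w n i : ℝ) * w n j * Y i j :=
    mul_nonneg (by positivity) (hY.nonneg i j)
  have hQa (n : ℕ) : Y i₀ i₀ * (a n : ℝ) ^ 2 ≤ Q n := by
    calc Y i₀ i₀ * (a n : ℝ) ^ 2 = (w n i₀ : ℝ) * w n i₀ * Y i₀ i₀ := by rw [ha]; ring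
      _ ≤ ∑ j, (w n i₀ : ℝ) * w n j * Y i₀ j :=
        Finset.single_le_sum (f := fun j => (w n i₀ : ℝ) * w n j * Y i₀ j)
          (fun j _ => hterm n i₀ j) (Finset.mem_univ i₀)
      _ ≤ Q n :=
        Finset.single_le_sum (f := fun i => ∑ j, (w n i : ℝ) * w n j * Y i j)
          (fun i _ => Finset.sum_nonneg fun j _ => hterm n i j) (Finset.mem_univ i₀)
  set T := ∑ i, ∑ j, Y i j with hT
  have hTpos : 0 < T := by
    refine hY0.trans_le ?_
    refine (Finset.single_le_sum (fun j _ => hY.nonneg i₀ j) (Finset.mem_univ i₀)).trans ?_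
    exact Finset.single_le_sum (f := fun i => ∑ j, Y i j)
      (fun i _ => Finset.sum_nonneg fun j _ => hY.nonneg i j) (Finset.mem_univ i₀)
  set S : ℕ → ℝ := fun n => (a (4 * n) : ℝ) ^ 2 + (a (4 * n + 1) : ℝ) ^ 2 +
    (a (4 * n + 2) : ℝ) ^ 2 + (a (4 * n + 3) : ℝ) ^ 2 with hS
  have hQS (n : ℕ) : Q n ≤ 4 * T * S n := by
    set B : ℝ := (a (4 * n) : ℝ) + a (4 * n + 1) + a (4 * n + 2) + a (4 * n + 3) with hB
    have hwB (i : Fin d) : (w n i : ℝ) ≤ B := by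
      simp only [hB]
      exact_mod_cast hcover n i
    have hBS : B ^ 2 ≤ 4 * S n := by
      simp only [hB, hS]
      nlinarith [sq_nonneg ((a (4 * n) : ℝ) - a (4 * n + 1)),
        sq_nonneg ((a (4 * n) : ℝ) - a (4 * n + 2)), sq_nonneg ((a (4 * n) : ℝ) - a (4 * n + 3)),
        sq_nonneg ((a (4 * n + 1) : ℝ) - a (4 * n + 2)),
        sq_nonneg ((a (4 * n + 1) : ℝ) - a (4 * n + 3)),
        sq_nonneg ((a (4 * n + 2) : ℝ) - a (4 * n + 3))]
    calc Q n ≤ ∑ i, ∑ j, B * B * Y i j := by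
          refine Finset.sum_le_sum fun i _ => Finset.sum_le_sum fun j _ => ?_
          refine mul_le_mul_of_nonneg_right ?_ (hY.nonneg i j)
          exact mul_le_mul (hwB i) (hwB j) (Nat.cast_nonneg _) ((Nat.cast_nonneg _).trans (hwB i))
      _ = T * B ^ 2 := by
        simp only [← Finset.mul_sum, hT]
        ring
      _ ≤ T * (4 * S n) := mul_le_mul_of_nonneg_left hBS hTpos.le
      _ = 4 * T * S n := by ring
  have hSsum (m : ℕ) : ∑ k ∈ Finset.range (2 ^ (m + 2)), (a k : ℝ) ^ 2 =
      ∑ k ∈ Finset.range (2 ^ m), S k := by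
    rw [pow_succ', pow_succ', sum_range_two_mul, sum_range_two_mul]
    refine Finset.sum_congr rfl fun k _ => ?_
    simp only [hS]
    ring_nf
  have hQ0 : 0 < Q 0 := lt_of_lt_of_le (by positivity) (hQa 0)
  refine hasAverageDispersion_of_dyadic_bounds (c := Q 0 / (4 * T * (2 * r) ^ 2))
    (C := Q 0 / Y i₀ i₀) (C' := L 0 / v i₀) hr hρr (by positivity) ?_ ?_ ?_
  · intro m hm
    obtain ⟨m, rfl⟩ := Nat.exists_eq_add_of_le' hm
    rw [hSsum, pow_add, div_mul_eq_mul_div, div_le_iff₀ (by positivity)]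
    have := Finset.sum_le_sum fun k (_ : k ∈ Finset.range (2 ^ m)) => hQS k
    rw [hQsum, ← Finset.mul_sum] at this
    have := mul_le_mul_of_nonneg_right this (sq_nonneg (2 * r))
    linarith
  · intro m
    rw [div_mul_eq_mul_div, le_div_iff₀ hY0]
    have := Finset.sum_le_sum fun k (_ : k ∈ Finset.range (2 ^ m)) => hQa k
    rw [hQsum, ← Finset.mul_sum] at this
    linarith
  · intro m
    rw [div_mul_eq_mul_div, le_div_iff₀ hv0]
    have := (Finset.sum_le_sum fun k (_ : k ∈ Finset.range (2 ^ m)) => hLa k).trans (hLsum m)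
    rw [← Finset.mul_sum] at this
    linarith

/-! ### Explicit Kronecker eigenvectors -/

theorem isKroneckerEigenvector_binomial :
    IsKroneckerEigenvector !![1] !![2] !![1] (5 / 2) := by
  constructor
  · intro i j
    fin_cases i; fin_cases j
    simp
  · intro i j
    fin_cases i; fin_cases j
    simp
  · intro i j
    fin_cases i; fin_cases j
    norm_num

theorem isKroneckerEigenvector_fibonacci {r : ℝ} (hr1 : 1 < r) (hr : 2 * r ^ 2 - 5 * r + 1 = 0) :
    IsKroneckerEigenvector !![1, 0; 1, 1] !![1, 1; 0, 1] !![r - 1, 1; 1, r - 1] r := by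
  have h : 0 < r - 1 := by linarith
  constructor
  · intro i j
    fin_cases i <;> fin_cases j <;> simp [h.le]
  · intro i j
    fin_cases i <;> fin_cases j <;> simp [h.ne']
  · intro i j
    fin_cases i <;> fin_cases j <;> simp [Fin.sum_univ_two] <;> linarith

theorem isKroneckerEigenvector_trinomial {r : ℝ} (hr1 : 1 < r)
    (hr : r ^ 3 - 2 * r ^ 2 - 3 * r + 2 = 0) :
    IsKroneckerEigenvector !![1, 2; 0, 0] !![1, 2; 1, 0]
      !![2 * r, r / (r - 1); r / (r - 1), 1] r := by
  have h : 0 < r - 1 := by linarith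
  have hq : 0 < r / (r - 1) := by positivity
  have hq' : r / (r - 1) * (r - 1) = r := div_mul_cancel₀ _ h.ne'
  have hq2 : 4 * (r / (r - 1)) = 2 * r ^ 2 - 2 * r - 4 := by
    field_simp
    linarith
  set q := r / (r - 1) with hq_def
  have h0 : 0 < r := by linarith
  constructor
  · intro i j
    fin_cases i <;> fin_cases j <;> simp [hq.le, h0.le]
  · intro i j
    fin_cases i <;> fin_cases j <;> simp [hq.ne', h0.ne']
  · intro i j
    fin_cases i <;> fin_cases j <;> simp [Fin.sum_univ_two] <;> linarith

theorem exists_isKroneckerEigenvector_rhombus {r : ℝ} (hr1 : 3.194 ≤ r) (hr2 : r < 3.195)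
    (hr : 4 * r ^ 7 - 8 * r ^ 6 - 25 * r ^ 5 + 22 * r ^ 4 + 24 * r ^ 3 + 16 * r ^ 2 + r - 2 = 0) :
    ∃ Y : Matrix (Fin 5) (Fin 5) ℝ, 0 < Y 0 0 ∧ IsKroneckerEigenvector
      !![0, 1, 0, 0, 0; 1, 0, 2, 0, 0; 0, 0, 0, 0, 0; 0, 1, 0, 0, 1; 0, 0, 0, 2, 1]
      !![1, 0, 2, 0, 0; 0, 0, 0, 2, 1; 1, 1, 0, 0, 0; 0, 0, 0, 0, 0; 0, 1, 0, 0, 0] Y r := by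
  have hr0 : 0 < r := by linarith
  have hr3 : 0 < r - 1 := by linarith
  -- The permutation 0↔4, 2↔3 exchanges D₀ and D₁, so Y is sought symmetric and invariant under it.
  -- Normalizing Y₁₁ = 2r forces Y₀₀ = r+1. The entries h, c, k, d, e are then expressed through b,
  -- and `ea` becomes M b = N.
  set D := r ^ 2 - r - 1 with hD_def
  have hD : 0 < D := by nlinarith
  set M := 2 * r * D + 2 * r * (2 + r) + 4 * (r - 1) * D with hM_def
  have hM : 0 < M := by positivity
  set N := (2 * r + 1) * (r - 1) ^ 2 * r * D - 2 * r * ((r + 1) * D + 2 * r) -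
    2 * (3 * r + 1) * (r - 1) * D with hN_def
  -- Expanded at 3, N has only positive coefficients.
  have hN : 0 < N := by
    have ht : 0 < r - 3 := by linarith
    have : N = 64 + 526 * (r - 3) + 831 * (r - 3) ^ 2 + 560 * (r - 3) ^ 3 + 188 * (r - 3) ^ 4 +
        31 * (r - 3) ^ 5 + 2 * (r - 3) ^ 6 := by
      simp only [hN_def, hD_def]
      ring
    rw [this]
    positivity
  obtain ⟨b, hb_def⟩ : ∃ b, b = N / M := ⟨_, rfl⟩
  have hb : 0 < b := hb_def ▸ by positivity
  obtain ⟨h, hh_def⟩ : ∃ h, h = (2 * r + (2 + r) * b) / (2 * D) := ⟨_, rfl⟩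
  have hh : 0 < h := hh_def ▸ by positivity
  obtain ⟨c, hc_def⟩ : ∃ c, c = (r + 1 + b + 2 * h) / (2 * (r - 1)) := ⟨_, rfl⟩
  have hc : 0 < c := hc_def ▸ by positivity
  obtain ⟨k, hk_def⟩ : ∃ k, k = (3 * r + 1 + 2 * b) / (2 * r) := ⟨_, rfl⟩
  have hk : 0 < k := hk_def ▸ by positivity
  obtain ⟨d, hd_def⟩ : ∃ d, d = (2 * r + b) / (2 * r) := ⟨_, rfl⟩
  have hd : 0 < d := hd_def ▸ by positivity
  obtain ⟨e, he_def⟩ : ∃ e, e = (2 * h + b) / r := ⟨_, rfl⟩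
  have he : 0 < e := he_def ▸ by positivity
  have eb : M * b = N := by rw [hb_def]; field_simp
  have eh : 2 * D * h = 2 * r + (2 + r) * b := by rw [hh_def]; field_simp
  have ec : 2 * (r - 1) * c = r + 1 + b + 2 * h := by rw [hc_def]; field_simp
  have ek : 2 * r * k = 3 * r + 1 + 2 * b := by rw [hk_def]; field_simp
  have ed : 2 * r * d = 2 * r + b := by rw [hd_def]; field_simp
  have ee : r * e = 2 * h + b := by rw [he_def]; field_simp
  have ea : 2 * r ^ 2 - r - 1 = 4 * c + 4 * k := by
    have : (2 * r * (r - 1) * D) * (2 * r ^ 2 - r - 1 - 4 * c - 4 * k) = 0 := by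
      simp only [hM_def, hN_def] at eb
      linear_combination (-4 * r * D) * ec + (-4 * (r - 1) * D) * ek + (-4 * r) * eh - 2 * eb
    have := (mul_eq_zero.1 this).resolve_left (by positivity)
    linarith
  have eh2 : 2 * (r - 1) * h = 2 * d + e + b := by
    have : r * (2 * (r - 1) * h - (2 * d + e + b)) = 0 := by
      linear_combination eh - ed - ee
    have := (mul_eq_zero.1 this).resolve_left hr0.ne'
    linarith
  -- The one remaining eigenvector equation; it is the compatibility condition where the septic
  -- enters.
  have eb2 : (2 * r - 1) * b = 2 * h + 4 * d + e := by
    have : (D * M * r) * ((2 * r - 1) * b - 2 * h - 4 * d - e) = 0 := by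
      simp only [hM_def, hN_def, hD_def] at eb eh ⊢
      linear_combination (-2 * D * M) * ed - D * M * ee - (r + 1) * M * eh +
        ((2 * r - 3) * (r + 1) * D - (r + 1) * (r + 2)) * eb + (r ^ 3 - 2 * r ^ 2 + 1) * hr
    have := (mul_eq_zero.1 this).resolve_left (by positivity)
    linarith
  have ha : 0 < r + 1 := by positivity
  have hg : 0 < 2 * r := by positivity
  -- The entries (2,3) and (3,2) vanish because row 2 of D₀ and row 3 of D₁ are zero.
  refine ⟨!![r + 1, b, c, d, e; b, 2 * r, h, h, b; c, h, k, 0, d; d, h, 0, k, c;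
    e, b, d, c, r + 1], ha, ?_, ?_, ?_⟩
  · intro i j
    fin_cases i <;> fin_cases j <;>
      first
      | exact le_rfl
      | exact ha.le
      | exact hb.le
      | exact hc.le
      | exact hd.le
      | exact he.le
      | exact hg.le
      | exact hh.le
      | exact hk.le
  · intro i j
    fin_cases i <;> fin_cases j <;>
      first
      | exact fun h0 => absurd h0 ha.ne'
      | exact fun h0 => absurd h0 hb.ne'
      | exact fun h0 => absurd h0 hc.ne'
      | exact fun h0 => absurd h0 hd.ne'
      | exact fun h0 => absurd h0 he.ne'
      | exact fun h0 => absurd h0 hg.ne'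
      | exact fun h0 => absurd h0 hh.ne'
      | exact fun h0 => absurd h0 hk.ne'
      | exact fun _ => by decide
  · intro i j
    fin_cases i <;> fin_cases j <;> simp [Fin.sum_univ_five] <;> linarith

/-! ### Average dispersion of the four sequences -/

theorem hasAverageDispersion_oddBinomial :
    HasAverageDispersion oddBinomial (Real.log (5 / 2) / Real.log 2) := by
  have hw := oddBinomial_representation
  have he (n : ℕ) : oddBinomial (2 * n) = oddBinomial n := by
    simpa [Matrix.vecMul, dotProduct] using congrFun (hw.even n) 0
  refine hasAverageDispersion_of_representation (i₀ := 0) (v := fun _ => 1) (ρ := 3 / 2)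
    isKroneckerEigenvector_binomial hw (fun n => rfl) ?_ (by simp) ?_ (fun _ => zero_le_one)
    one_pos ?_ (by norm_num) (by norm_num)
  · simp [oddBinomial, oddCoeffCount_eq_card_support]
  · intro n i
    fin_cases i
    have h1 := he (2 * n)
    have h2 := he n
    rw [show 2 * (2 * n) = 4 * n by ring] at h1
    simp
    omega
  · intro i
    fin_cases i
    norm_num

theorem hasAverageDispersion_oddFibonacci :
    HasAverageDispersion oddFibonacci (Real.log ((5 + Real.sqrt 17) / 4) / Real.log 2) := by
  obtain ⟨w, hw, ha⟩ := oddFibonacci_representation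
  have hs : Real.sqrt 17 ^ 2 = 17 := Real.sq_sqrt (by norm_num)
  have hs4 : (4.1 : ℝ) < Real.sqrt 17 := Real.lt_sqrt_of_sq_lt (by norm_num)
  have he (n : ℕ) : w (2 * n) 0 = w n 0 + w n 1 ∧ w (2 * n) 1 = w n 1 := by
    rw [hw.even]
    simp [Matrix.vecMul, dotProduct, Fin.sum_univ_two]
  have ho (n : ℕ) : w (2 * n + 1) 0 = w n 0 := by
    rw [hw.odd]
    simp [Matrix.vecMul, dotProduct, Fin.sum_univ_two]
  -- D₀+D₁ has constant row sums 3, and (3/2)² = 9/4 < ψ.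
  refine hasAverageDispersion_of_representation (i₀ := 0) (v := fun _ => 1) (ρ := 3 / 2)
    (isKroneckerEigenvector_fibonacci (by linarith) (by nlinarith)) hw ha ?_ ?_ ?_
    (fun _ => zero_le_one) one_pos ?_ (by norm_num) (by linarith)
  · simp [oddFibonacci, oddCoeffCount_eq_card_support, fibonacciPoly]
  · simp
    linarith
  · intro n i
    have h1 := he (2 * n)
    have h2 := he n
    have h3 := ho (2 * n)
    rw [show 2 * (2 * n) = 4 * n by ring] at h1 h3
    simp only [← ha]
    fin_cases i <;> simp only [Fin.mk_zero, Fin.mk_one] <;> omega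
  · intro i
    fin_cases i <;> norm_num [Fin.sum_univ_two]

theorem hasAverageDispersion_oddTrinomial {r : ℝ} (hr1 : 2.813 ≤ r)
    (hr : r ^ 3 - 2 * r ^ 2 - 3 * r + 2 = 0) :
    HasAverageDispersion oddTrinomial (Real.log r / Real.log 2) := by
  obtain ⟨w, hw, ha⟩ := oddTrinomial_representation
  have he (n : ℕ) : w (2 * n) 0 = w n 0 := by
    rw [hw.even]
    simp [Matrix.vecMul, dotProduct, Fin.sum_univ_two]
  have ho (n : ℕ) : w (2 * n + 1) 0 = w n 0 + w n 1 := by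
    rw [hw.odd]
    simp [Matrix.vecMul, dotProduct, Fin.sum_univ_two]
  -- A rounded Perron vector of D₀+D₁, whose eigenvalue is 1+√5 ≈ 3.236 < 3.3; and 1.65² < 2.813.
  refine hasAverageDispersion_of_representation (i₀ := 0) (v := ![16, 5]) (ρ := 1.65)
    (isKroneckerEigenvector_trinomial (by linarith) hr) hw ha ?_ ?_ ?_ ?_ (by simp) ?_
    (by norm_num) (by linarith)
  · simp [oddTrinomial, oddCoeffCount_eq_card_support]
  · simp
    linarith
  · intro n i
    have h1 := he (2 * n)
    have h2 := he n
    have h3 := he (2 * n + 1)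
    have h4 := ho n
    rw [show 2 * (2 * n) = 4 * n by ring] at h1
    rw [show 2 * (2 * n + 1) = 4 * n + 2 by ring] at h3
    simp only [← ha]
    fin_cases i <;> simp only [Fin.mk_zero, Fin.mk_one] <;> omega
  · intro i
    fin_cases i <;> norm_num
  · intro i
    fin_cases i <;> norm_num [Fin.sum_univ_two]

theorem hasAverageDispersion_oddRhombus {r : ℝ} (hr1 : 3.194 ≤ r) (hr2 : r < 3.195)
    (hr : 4 * r ^ 7 - 8 * r ^ 6 - 25 * r ^ 5 + 22 * r ^ 4 + 24 * r ^ 3 + 16 * r ^ 2 + r - 2 = 0) :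
    HasAverageDispersion oddRhombus (Real.log r / Real.log 2) := by
  obtain ⟨w, hw, ha⟩ := oddRhombus_representation
  obtain ⟨Y, hY0, hY⟩ := exists_isKroneckerEigenvector_rhombus hr1 hr2 hr
  have he (n : ℕ) : w (2 * n) 0 = w n 1 ∧ w (2 * n) 1 = w n 0 + w n 3 ∧
      w (2 * n) 2 = 2 * w n 1 := by
    rw [hw.even]
    simp [Matrix.vecMul, dotProduct, Fin.sum_univ_five, mul_comm]
  have ho (n : ℕ) : w (2 * n + 1) 0 = w n 0 + w n 2 ∧ w (2 * n + 1) 1 = w n 2 + w n 4 := by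
    rw [hw.odd]
    simp [Matrix.vecMul, dotProduct, Fin.sum_univ_five]
  -- A rounded Perron vector of D₀+D₁, whose eigenvalue is (3+√17)/2 ≈ 3.562. The margin is narrow:
  -- 2ρ = 3.57 must exceed it while ρ² ≈ 3.186 stays below 3.194.
  refine hasAverageDispersion_of_representation (i₀ := 0) (v := ![100, 128.2, 64, 64, 100])
    (ρ := 1.785) hY hw ha ?_ hY0 ?_ ?_ (by simp) ?_ (by norm_num) (by linarith)
  · simp [oddRhombus, oddCoeffCount_eq_card_support, rhombusPoly]
  · intro n i
    have h1 := he (2 * n)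
    have h2 := he n
    have h3 := he (2 * n + 1)
    have h4 := ho n
    have h5 := ho (2 * n)
    rw [show 2 * (2 * n) = 4 * n by ring] at h1 h5
    rw [show 2 * (2 * n + 1) = 4 * n + 2 by ring] at h3
    simp only [← ha]
    fin_cases i <;> simp only [Fin.mk_zero, Fin.mk_one, Fin.reduceFinMk] <;> omega
  · intro i
    fin_cases i <;> norm_num
  · intro i
    fin_cases i <;> simp [Fin.sum_univ_five] <;> norm_num

/-! ### Location of the roots and conclusion -/

theorem exists_root_cubic : ∃ ξ : ℝ, 2.813 ≤ ξ ∧ ξ < 2.814 ∧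
    ξ ^ 3 - 2 * ξ ^ 2 - 3 * ξ + 2 = 0 := by
  obtain ⟨x, hx, h⟩ := intermediate_value_Ico (a := (2.813 : ℝ)) (b := 2.814) (by norm_num)
    (f := fun x : ℝ => x ^ 3 - 2 * x ^ 2 - 3 * x + 2) (by fun_prop)
    (show (0 : ℝ) ∈ _ by constructor <;> norm_num)
  exact ⟨x, hx.1, hx.2, h⟩

theorem exists_root_septic : ∃ η : ℝ, 3.194 ≤ η ∧ η < 3.195 ∧
    4 * η ^ 7 - 8 * η ^ 6 - 25 * η ^ 5 + 22 * η ^ 4 + 24 * η ^ 3 + 16 * η ^ 2 + η - 2 = 0 := by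
  obtain ⟨x, hx, h⟩ := intermediate_value_Ico (a := (3.194 : ℝ)) (b := 3.195) (by norm_num)
    (f := fun η : ℝ => 4 * η ^ 7 - 8 * η ^ 6 - 25 * η ^ 5 + 22 * η ^ 4 + 24 * η ^ 3 +
      16 * η ^ 2 + η - 2) (by fun_prop)
    (show (0 : ℝ) ∈ _ by constructor <;> norm_num)
  exact ⟨x, hx.1, hx.2, h⟩

theorem mainTheorem8 :
    (IsLeadingEigenvalue (kroneckerMean binomialD₀ binomialD₁) ((5 / 2 : ℝ) : ℂ) ∧
      HasAverageDispersion oddBinomial (Real.log (5 / 2) / Real.log 2)) ∧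
    (IsLeadingEigenvalue (kroneckerMean fibonacciD₀ fibonacciD₁)
        (((5 + Real.sqrt 17) / 4 : ℝ) : ℂ) ∧
      HasAverageDispersion oddFibonacci (Real.log ((5 + Real.sqrt 17) / 4) / Real.log 2)) ∧
    (∃ ξ : ℝ, 2.813 ≤ ξ ∧ ξ < 2.814 ∧
      minpoly ℚ ξ = X ^ 3 - 2 * X ^ 2 - 3 * X + 2 ∧
      IsLeadingEigenvalue (kroneckerMean trinomialD₀ trinomialD₁) (ξ : ℂ) ∧
      HasAverageDispersion oddTrinomial (Real.log ξ / Real.log 2)) ∧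
    (∃ η : ℝ, 3.194 ≤ η ∧ η < 3.195 ∧
      4 * minpoly ℚ η =
        4 * X ^ 7 - 8 * X ^ 6 - 25 * X ^ 5 + 22 * X ^ 4 + 24 * X ^ 3 + 16 * X ^ 2 + X - 2 ∧
      IsLeadingEigenvalue (kroneckerMean rhombusD₀ rhombusD₁) (η : ℂ) ∧
      HasAverageDispersion oddRhombus (Real.log η / Real.log 2)) := by
  refine ⟨⟨?_, hasAverageDispersion_oddBinomial⟩, ⟨?_, hasAverageDispersion_oddFibonacci⟩, ?_, ?_⟩
  · have := isKroneckerEigenvector_binomial.isLeadingEigenvalue (by norm_num)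
      (fun h => by simpa using congrFun₂ h 0 0)
    convert this using 2 <;> ext i j <;> fin_cases i <;> fin_cases j <;>
      simp [binomialD₀, binomialD₁]
  · have hs : Real.sqrt 17 ^ 2 = 17 := Real.sq_sqrt (by norm_num)
    have hs4 : (4.1 : ℝ) < Real.sqrt 17 := Real.lt_sqrt_of_sq_lt (by norm_num)
    have := (isKroneckerEigenvector_fibonacci (r := (5 + Real.sqrt 17) / 4) (by linarith)
      (by nlinarith)).isLeadingEigenvalue (by positivity)
      (fun h => by simpa using congrFun₂ h 0 1)
    convert this using 2 <;> ext i j <;> fin_cases i <;> fin_cases j <;>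
      simp [fibonacciD₀, fibonacciD₁]
  · obtain ⟨ξ, h1, h2, h⟩ := exists_root_cubic
    refine ⟨ξ, h1, h2, minpoly_eq_cubic h, ?_, hasAverageDispersion_oddTrinomial h1 h⟩
    have := (isKroneckerEigenvector_trinomial (by linarith) h).isLeadingEigenvalue (by linarith)
      (fun h => by simpa using congrFun₂ h 1 1)
    convert this using 2 <;> ext i j <;> fin_cases i <;> fin_cases j <;>
      simp [trinomialD₀, trinomialD₁]
  · obtain ⟨η, h1, h2, h⟩ := exists_root_septic
    refine ⟨η, h1, h2, four_mul_minpoly_eq h, ?_, hasAverageDispersion_oddRhombus h1 h2 h⟩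
    obtain ⟨Y, hY0, hY⟩ := exists_isKroneckerEigenvector_rhombus h1 h2 h
    have := hY.isLeadingEigenvalue (by linarith) (fun h => by simp [h] at hY0)
    convert this using 2 <;> ext i j <;> fin_cases i <;> fin_cases j <;>
      simp [rhombusD₀, rhombusD₁]
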